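/- Let $L_1,\dots,L_8$ be real $8\times 8$ signed permutation matrices (each row and each column has exactly one non-zero entry, which is $\pm1$). They are said to realize $\mathcal{GR}(8,8)$ if for all $I,J\in\{1,\dots,8\}$ $$L_IL_J^T+L_JL_I^T=2\delta_{IJ}\,\mathbb I,\qquad L_I^TL_J+L_J^TL_I=2\delta_{IJ}\,\mathbb I .$$ Write $|L|$ for the entrywise absolute value of $L$, which is a permutation matrix and is identified with an element of $S_8$. Let $A\subset S_8$ be the subgroup consisting of $(\,)$, $(1\,2)(3\,4)(5\,6)(7\,8)$, $(1\,3)(2\,4)(5\,7)(6\,8)$, $(1\,5)(2\,6)(3\,7)(4\,8)$, $(1\,8)(2\,7)(3\,6)(4\,5)$, $(1\,7)(2\,8)(3\,5)(4\,6)$, $(1\,6)(2\,5)(3\,8)(4\,7)$, $(1\,4)(2\,3)(5\,8)(6\,7)$. (i) $A$ has exactly $30$ conjugate subgroups in $S_8$, and each of them has exactly $5040$ left cosets. The unordered sets $\{|L_1|,\dots,|L_8|\}$, where $L_1,\dots,L_8$ realize $\mathcal{GR}(8,8)$, are exactly the left cosets of the conjugates of $A$, and there are exactly $30\cdot 5040=151{,}200$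 such sets. (ii) For every realization $L_1,\dots,L_8$ of $\mathcal{GR}(8,8)$ there are exactly $2^{19}$ tuples $(\Sigma_1,\dots,\Sigma_8)$ of diagonal matrices with diagonal entries $\pm1$ such that $\Sigma_1|L_1|,\dots,\Sigma_8|L_8|$ realize $\mathcal{GR}(8,8)$. Moreover, each of the $151{,}200$ sets in (i) arises as $\{|L_1|,\dots,|L_8|\}$ from exactly $2^{19}$ unordered sets $\{L_1,\dots,L_8\}$ whose members realize $\mathcal{GR}(8,8)$. (iii) Consequently there are exactly $151{,}200\cdot 2^{19}=79{,}272{,}345{,}600$ unordered sets $\{L_1,\dots,L_8\}$ whose members realize $\mathcal{GR}(8,8)$. -/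

import Mathlib

namespace GardenAlgebra

/-- A signed permutation matrix: each row and each column has exactly one nonzero entry,
and the nonzero entries are `1` or `-1`. -/
def IsSignedPerm {d : ℕ} (M : Matrix (Fin d) (Fin d) ℝ) : Prop :=
  (∀ i, ∃! j, M i j ≠ 0) ∧ (∀ j, ∃! i, M i j ≠ 0) ∧
    ∀ i j, M i j ≠ 0 → M i j = 1 ∨ M i j = -1

/-- `L₁, …, L_N` are `d × d` signed permutation matrices satisfying the relations of the
`GR(d,N)` algebra. -/
def IsGR (d N : ℕ) (L : Fin N → Matrix (Fin d) (Fin d) ℝ) : Prop :=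
  (∀ I, IsSignedPerm (L I)) ∧
  (∀ I J, L I * (L J).transpose + L J * (L I).transpose =
    (2 * (if I = J then 1 else 0) : ℝ) • (1 : Matrix (Fin d) (Fin d) ℝ)) ∧
  (∀ I J, (L I).transpose * L J + (L J).transpose * L I =
    (2 * (if I = J then 1 else 0) : ℝ) • (1 : Matrix (Fin d) (Fin d) ℝ))

/-- The entrywise absolute value `|M|` of a matrix. -/
def absMatrix {d : ℕ} (M : Matrix (Fin d) (Fin d) ℝ) : Matrix (Fin d) (Fin d) ℝ :=
  M.map (fun x => |x|)

/-- All (unordered) sets `{L₁, …, L_N}` for `GR(d,N)`. -/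
def grSets (d N : ℕ) : Set (Set (Matrix (Fin d) (Fin d) ℝ)) :=
  {S | ∃ L, IsGR d N L ∧ S = Set.range L}

/-- All (unordered) sets `{|L₁|, …, |L_N|}` for `GR(d,N)`. -/
def grAbsSets (d N : ℕ) : Set (Set (Matrix (Fin d) (Fin d) ℝ)) :=
  {P | ∃ L, IsGR d N L ∧ P = Set.range (fun I => absMatrix (L I))}

/-- A diagonal matrix whose diagonal entries are `1` or `-1`. -/
def IsSignMatrix {d : ℕ} (M : Matrix (Fin d) (Fin d) ℝ) : Prop :=
  ∃ s : Fin d → ℝ, (∀ i, s i = 1 ∨ s i = -1) ∧ M = Matrix.diagonal s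

/-- The permutation matrix of `σ`, sending the basis vector `e_j` to `e_{σ j}`. -/
def permMat {d : ℕ} (σ : Equiv.Perm (Fin d)) : Matrix (Fin d) (Fin d) ℝ :=
  Matrix.of (fun i j => if i = σ j then 1 else 0)

open Equiv in
/-- The eight permutations `a₁, …, a₈`; the points `1, …, 8` are written `0, …, 7`. -/
def a : Fin 8 → Equiv.Perm (Fin 8) :=
  ![1,
    swap 0 1 * swap 2 3 * swap 4 5 * swap 6 7,
    swap 0 2 * swap 1 3 * swap 4 6 * swap 5 7,
    swap 0 4 * swap 1 5 * swap 2 6 * swap 3 7,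
    swap 0 7 * swap 1 6 * swap 2 5 * swap 3 4,
    swap 0 6 * swap 1 7 * swap 2 4 * swap 3 5,
    swap 0 5 * swap 1 4 * swap 2 7 * swap 3 6,
    swap 0 3 * swap 1 2 * swap 4 7 * swap 5 6]

set_option maxRecDepth 10000 in
theorem a_mul (i j : Fin 8) : ∃ k, a k = a i * a j := by
  revert i j; decide

set_option maxRecDepth 10000 in
theorem a_inv (i : Fin 8) : ∃ k, a k = (a i)⁻¹ := by
  revert i; decide

/-- The subgroup `A = {a₁, …, a₈}` of `S₈`. -/
def A : Subgroup (Equiv.Perm (Fin 8)) where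
  carrier := Set.range a
  mul_mem' := by
    rintro _ _ ⟨i, rfl⟩ ⟨j, rfl⟩
    exact a_mul i j
  one_mem' := ⟨0, rfl⟩
  inv_mem' := by
    rintro _ ⟨i, rfl⟩
    exact a_inv i

/-- The set of subgroups `g A g⁻¹` of `S₈`. -/
def conjugatesOfA : Set (Subgroup (Equiv.Perm (Fin 8))) :=
  {B | ∃ g : Equiv.Perm (Fin 8), B = A.map (MulAut.conj g).toMonoidHom}

/-- The set of permutation matrices of the elements of the left coset `π B`. -/
def cosetMatrices (π : Equiv.Perm (Fin 8)) (B : Subgroup (Equiv.Perm (Fin 8))) :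
    Set (Matrix (Fin 8) (Fin 8) ℝ) :=
  {M | ∃ b ∈ B, M = permMat (π * b)}

end GardenAlgebra

namespace GardenAlgebra

/-! Identify the eight points with F₂³, so that `^^^` is addition and `A` is the group of
translations. For I ≠ J the relations force the underlying permutations π_I, π_J to differ
everywhere and π_I⁻¹π_J to be an involution (`IsGR.perm_relations`). Dividing by π_0 leaves eight
commuting involutions that differ everywhere, i.e. a regular elementary abelian group of order 8.
Such a group is isomorphic to `A`, and isomorphic regular groups are conjugate, so the π_I form a
left coset of a conjugate of `A` (`IsGR.exists_perm`).

Multiplication by permutation matrices reduces the choice of signs to the translations themselves,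
where the relations become an affine system over F₂ in 64 bits (`isGR_signedMat_xorPerm_iff`). Its
solutions are the octonion signs plus a space of dimension 8 + 7 + 4 = 19 (`ncard_isComposition`).
In particular every coset does occur.

The remaining counts are by fibres: the normalizer of `A` is AGL(3,2), of order 1344, giving 8!/1344
= 30 conjugates with 8!/8 cosets each. The members of a coset are distinct, so unordered sets with
given absolute values correspond to tuples of signs. -/

/-- Counting by fibres of constant cardinality. -/
theorem ncard_eq_mul_of_fibers {α β : Type*} (f : α → β) {s : Set α} {t : Set β} {m : ℕ}
    (hm : m ≠ 0) (ht : t.Finite) (hst : Set.MapsTo f s t)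
    (h : ∀ y ∈ t, {x | x ∈ s ∧ f x = y}.ncard = m) : s.ncard = t.ncard * m := by
  classical
  -- Infinite sets have `ncard` zero, so `m ≠ 0` makes every fibre finite.
  have hs : s.Finite := by
    refine (ht.biUnion (t := fun y => {x | x ∈ s ∧ f x = y}) fun y hy =>
      Set.finite_of_ncard_ne_zero (by rw [h y hy]; exact hm)).subset ?_
    intro x hx
    exact Set.mem_biUnion (hst hx) ⟨hx, rfl⟩
  rw [Set.ncard_eq_toFinset_card s hs, Set.ncard_eq_toFinset_card t ht,
    Finset.card_eq_sum_card_fiberwise (f := f) (t := ht.toFinset) (by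
      intro x hx; simpa using hst (by simpa using hx)), Finset.sum_const_nat (m := m)]
  intro y hy
  rw [← h y (by simpa using hy), ← Set.ncard_coe_finset]
  congr 1
  ext x
  simp

/-! ### Translations of F₂³ -/

theorem xor_xor_cancel (x v : Fin 8) : x ^^^ v ^^^ v = x := by revert x v; decide

theorem xor_assoc' (x y z : Fin 8) : x ^^^ y ^^^ z = x ^^^ (y ^^^ z) := by
  revert x y z; decide +kernel

theorem xor_comm' (x y : Fin 8) : x ^^^ y = y ^^^ x := by revert x y; decide

theorem xor_eq_iff (x y z : Fin 8) : x ^^^ y = z ↔ y = x ^^^ z := by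
  revert x y z; decide +kernel

/-- Translation by `v`, on `Fin 8` seen as the vector space of bit strings of length three. -/
def xorPerm (v : Fin 8) : Equiv.Perm (Fin 8) :=
  ⟨fun x => x ^^^ v, fun x => x ^^^ v, fun x => xor_xor_cancel x v, fun x => xor_xor_cancel x v⟩

@[simp] theorem xorPerm_apply (v x : Fin 8) : xorPerm v x = x ^^^ v := rfl

theorem mem_A_iff (g : Equiv.Perm (Fin 8)) : g ∈ A ↔ ∃ v, xorPerm v = g := by
  have h1 : ∀ i, ∃ v, xorPerm v = a i := by decide +kernel
  have h2 : ∀ v, ∃ i, a i = xorPerm v := by decide +kernel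
  constructor
  · rintro ⟨i, rfl⟩; exact h1 i
  · rintro ⟨v, rfl⟩; exact h2 v

theorem xorPerm_injective : Function.Injective xorPerm := by
  intro u v h
  have := congrArg (fun g => g 0) h
  revert this; revert u v; decide

/-! ### The affine system of signs and its 2^19 solutions -/

/-- Sign patterns for which the octonionic composition rule holds. -/
def IsComposition (f : Fin 8 → Fin 8 → Bool) : Prop :=
  ∀ u v x, u ≠ v →
    (f u x ^^ f v x ^^ (f u (x ^^^ u ^^^ v) ^^ f v (x ^^^ u ^^^ v))) = true

/-- The sign pattern of the octonions. -/
def octonionSign (u x : Fin 8) : Bool :=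
  let i := u.val.testBit; let j := x.val.testBit
  (i 0 && j 0) ^^ (i 0 && j 1) ^^ (i 0 && j 2) ^^ (i 1 && j 1) ^^ (i 1 && j 2) ^^ (i 2 && j 2) ^^
  (j 0 && i 1 && i 2) ^^ (i 0 && j 1 && i 2) ^^ (i 0 && i 1 && j 2)

/-- The coordinates of the cross product, and whether it is nonzero. -/
def crossSign (k : Fin 4) (u x : Fin 8) : Bool :=
  let c (m n : ℕ) : Bool := (u.val.testBit m && x.val.testBit n) ^^ (u.val.testBit n && x.val.testBit m)
  ![c 1 2, c 2 0, c 0 1, c 1 2 || c 2 0 || c 0 1] k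

/-- The sign pattern with row signs `r`, column signs `c` and coefficients `q`. -/
def paramSign (p : (Fin 8 → Bool) × (Fin 7 → Bool) × (Fin 4 → Bool)) (u x : Fin 8) : Bool :=
  octonionSign u x ^^ p.1 u ^^ (Fin.cons false p.2.1 : Fin 8 → Bool) x ^^
    (p.2.2 0 && crossSign 0 u x) ^^ (p.2.2 1 && crossSign 1 u x) ^^
    (p.2.2 2 && crossSign 2 u x) ^^ (p.2.2 3 && crossSign 3 u x)

theorem isComposition_octonionSign : ∀ u v x : Fin 8, u ≠ v →
    (octonionSign u x ^^ octonionSign v x ^^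
      (octonionSign u (x ^^^ u ^^^ v) ^^ octonionSign v (x ^^^ u ^^^ v))) = true := by
  decide +kernel

/-- These are solutions of the homogeneous system. The first three are alternating bilinear forms;
the last takes the value 1 four times when u, v, x are independent, and otherwise restricts to an
alternating form on a plane. -/
theorem crossSign_quad : ∀ (k : Fin 4) (u v x : Fin 8), u ≠ v →
    (crossSign k u x ^^ crossSign k v x ^^
      (crossSign k u (x ^^^ u ^^^ v) ^^ crossSign k v (x ^^^ u ^^^ v))) = false := by
  decide +kernel

theorem isComposition_paramSign (p) : IsComposition (paramSign p) := by
  intro u v x huv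
  have h := isComposition_octonionSign u v x huv
  have h0 := crossSign_quad 0 u v x huv
  have h1 := crossSign_quad 1 u v x huv
  have h2 := crossSign_quad 2 u v x huv
  have h3 := crossSign_quad 3 u v x huv
  -- Each row sign and each column sign enters the four-term sum twice.
  have key : ∀ o o' o'' o''' r r' c c' : Bool,
     ((o ^^ r ^^ c) ^^ (o' ^^ r' ^^ c) ^^ ((o'' ^^ r ^^ c') ^^ (o''' ^^ r' ^^ c'))) =
      (o ^^ o' ^^ (o'' ^^ o''')) := by decide
  have add : ∀ o o' o'' o''' q z z' z'' z''' : Bool, (z ^^ z' ^^ (z'' ^^ z''')) = false →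
     ((o ^^ (q && z)) ^^ (o' ^^ (q && z')) ^^ ((o'' ^^ (q && z'')) ^^ (o''' ^^ (q && z''')))) =
      (o ^^ o' ^^ (o'' ^^ o''')) := by decide
  simp only [paramSign]
  rw [add _ _ _ _ _ _ _ _ _ h3, add _ _ _ _ _ _ _ _ _ h2, add _ _ _ _ _ _ _ _ _ h1,
    add _ _ _ _ _ _ _ _ _ h0, key, h]

/-- The positions determining a sign pattern. -/
def pivots : List (Fin 8 × Fin 8) :=
  (List.finRange 8).map (fun i => (i, 0)) ++ (List.finRange 7).map (fun j => (0, j.succ)) ++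
    [(2, 4), (4, 1), (1, 2), (3, 4)]

theorem length_pivots : pivots.length = 19 := by decide

/-- One round of deducing further positions from three known ones. -/
def propagate (l : List (Fin 8 × Fin 8)) : List (Fin 8 × Fin 8) :=
  (List.finRange 8 ×ˢ List.finRange 8).filter fun p => p ∈ l ∨ ∃ v, v ≠ p.1 ∧
    (v, p.2) ∈ l ∧ (p.1, p.2 ^^^ p.1 ^^^ v) ∈ l ∧ (v, p.2 ^^^ p.1 ^^^ v) ∈ l

/-- Six rounds reach all 64 positions. -/
theorem mem_propagate_pivots : ∀ p, p ∈ propagate^[6] pivots := by decide +kernel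

/-- The composition rule ties together four positions, so three of the values fix the fourth. -/
theorem IsComposition.eq_on_propagate {f g : Fin 8 → Fin 8 → Bool} (hf : IsComposition f)
    (hg : IsComposition g) {l : List (Fin 8 × Fin 8)} (h : ∀ p ∈ l, f p.1 p.2 = g p.1 p.2) :
    ∀ p ∈ propagate l, f p.1 p.2 = g p.1 p.2 := by
  rintro ⟨u, x⟩ hp
  simp only [propagate, List.mem_filter, decide_eq_true_eq] at hp
  rcases hp.2 with hp | ⟨v, hv, h1, h2, h3⟩
  · exact h _ hp
  · have e1 := h _ h1
    have e2 := h _ h2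
    have e3 := h _ h3
    have f1 := hf u v x hv.symm
    have g1 := hg u v x hv.symm
    simp only at e1 e2 e3 ⊢
    rw [e1, e2, e3] at f1
    rw [← g1] at f1
    simpa using f1

theorem IsComposition.ext {f g : Fin 8 → Fin 8 → Bool} (hf : IsComposition f)
    (hg : IsComposition g) (h : ∀ p ∈ pivots, f p.1 p.2 = g p.1 p.2) : f = g := by
  have key : ∀ n, ∀ p ∈ propagate^[n] pivots, f p.1 p.2 = g p.1 p.2 := by
    intro n
    induction n with
    | zero => exact h
    | succ n ih =>
      rw [Function.iterate_succ_apply']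
      exact hf.eq_on_propagate hg ih
  funext u x
  exact key 6 (u, x) (mem_propagate_pivots _)

/-- The cross terms vanish on row 0 and column 0. The column sign at 0 is normalized to `false`,
since flipping all rows equals flipping all columns; so column 0 gives the row signs, and then row 0
the column signs. The last four pivots give an invertible system for the coefficients. -/
theorem paramSign_injective : Function.Injective paramSign := by
  rintro ⟨r, c, q⟩ ⟨r', c', q'⟩ h
  have hr : r = r' := by
    funext i
    have := congrFun (congrFun h i) 0
    have z : ∀ k i, crossSign k i 0 = false := by decide
    simpa [paramSign, z] using this
  subst hr
  have hc : c = c' := by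
    funext i
    have := congrFun (congrFun h 0) i.succ
    have z : ∀ k i, crossSign k 0 i = false := by decide
    simpa [paramSign, z] using this
  subst hc
  have h1 := congrFun (congrFun h 2) 4
  have h2 := congrFun (congrFun h 4) 1
  have h3 := congrFun (congrFun h 1) 2
  have h4 := congrFun (congrFun h 3) 4
  simp [paramSign, crossSign, Nat.testBit] at h1 h2 h3 h4
  have hq : q = q' := by
    funext i
    revert h1 h2 h3 h4
    fin_cases i <;> simp <;> generalize q 0 = x0 <;> generalize q 1 = x1 <;>
     generalize q 2 = x2 <;> generalize q 3 = x3 <;> generalize q' 0 = y0 <;>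
     generalize q' 1 = y1 <;> generalize q' 2 = y2 <;> generalize q' 3 = y3 <;>
     revert x0 x1 x2 x3 y0 y1 y2 y3 <;> decide
  rw [hq]

theorem ncard_isComposition : {f | IsComposition f}.ncard = 2 ^ 19 := by
  apply le_antisymm
  · have : Function.Injective fun (f : {f | IsComposition f}) (i : Fin pivots.length) =>
        f.1 (pivots.get i).1 (pivots.get i).2 := by
      rintro ⟨f, hf⟩ ⟨g, hg⟩ h
      refine Subtype.ext (hf.ext hg fun p hp => ?_)
      obtain ⟨i, rfl⟩ := List.get_of_mem hp
      exact congrFun h i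
    have := Nat.card_le_card_of_injective _ this
    simpa [length_pivots] using this
  · have := Set.ncard_le_ncard (s := Set.range paramSign) (t := {f | IsComposition f})
      (by rintro _ ⟨p, rfl⟩; exact isComposition_paramSign p) (Set.toFinite _)
    rw [← Set.image_univ, Set.ncard_image_of_injective _ paramSign_injective] at this
    simpa [Set.ncard_univ, Nat.card_eq_fintype_card] using this

/-! ### Regular elementary abelian permutation groups -/

theorem mul_comm_of_mul_self {G : Type*} [Group G] (hG : ∀ g : G, g * g = 1) (x y : G) :
    x * y = y * x := by
  have hi : ∀ g : G, g⁻¹ = g := fun g => inv_eq_of_mul_eq_one_left (hG g)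
  rw [← hi (x * y), mul_inv_rev, hi, hi]

/-- Finite groups of exponent two are determined by their cardinality. -/
theorem nonempty_mulEquiv_of_mul_self {G H : Type*} [Group G] [Group H] [Finite G] [Finite H]
    (hG : ∀ g : G, g * g = 1) (hH : ∀ h : H, h * h = 1) (hc : Nat.card G = Nat.card H) :
    Nonempty (G ≃* H) := by
  let _ : CommGroup G := { ‹Group G› with mul_comm := mul_comm_of_mul_self hG }
  let _ : CommGroup H := { ‹Group H› with mul_comm := mul_comm_of_mul_self hH }
  let _ : Module (ZMod 2) (Additive G) := AddCommGroup.zmodModule fun x => by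
    rw [two_nsmul]; exact hG x.toMul
  let _ : Module (ZMod 2) (Additive H) := AddCommGroup.zmodModule fun x => by
    rw [two_nsmul]; exact hH x.toMul
  have h1 := Module.natCard_eq_pow_finrank (K := ZMod 2) (V := Additive G)
  have h2 := Module.natCard_eq_pow_finrank (K := ZMod 2) (V := Additive H)
  have hc' : Nat.card (Additive G) = Nat.card (Additive H) := hc
  rw [h1, h2] at hc'
  have hr := Nat.pow_right_injective (by simp) hc'
  exact ⟨MulEquiv.toAdditive.symm (LinearEquiv.ofFinrankEq _ _ hr).toAddEquiv⟩

/-- Isomorphic regular permutation groups are conjugate. -/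
theorem exists_conj_of_regular {X : Type*} {G H : Subgroup (Equiv.Perm X)} (φ : G ≃* H) (o : X)
    (hG : Function.Bijective fun g : G => g.1 o) (hH : Function.Bijective fun h : H => h.1 o) :
    ∃ c : Equiv.Perm X, H = G.map (MulAut.conj c).toMonoidHom := by
  -- By regularity every point is g o for a unique g; the conjugator sends it to φ(g) o.
  let c : Equiv.Perm X := (Equiv.ofBijective _ hG).symm.trans
    (φ.toEquiv.trans (Equiv.ofBijective _ hH))
  have hc : ∀ g : G, c (g.1 o) = (φ g).1 o := by
    intro g
    have : (Equiv.ofBijective _ hG).symm (g.1 o) = g :=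
      (Equiv.ofBijective _ hG).symm_apply_apply g
    simp [c, this]
  have key : ∀ g : G, c * g.1 * c⁻¹ = (φ g).1 := by
    intro g
    rw [mul_inv_eq_iff_eq_mul]
    ext x
    obtain ⟨k, rfl⟩ := hG.2 x
    have := hc (g * k)
    simp only [map_mul, Subgroup.coe_mul, Equiv.Perm.mul_apply] at this
    simp only [Equiv.Perm.mul_apply, hc, this]
  refine ⟨c, ?_⟩
  ext h
  simp only [Subgroup.mem_map, MulEquiv.coe_toMonoidHom, MulAut.conj_apply]
  constructor
  · intro hh
    refine ⟨φ.symm ⟨h, hh⟩, Subtype.property _, ?_⟩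
    rw [key]; simp
  · rintro ⟨g, hg, rfl⟩
    rw [key ⟨g, hg⟩]
    exact Subtype.property _

/-- A family of `card X` commuting involutions of `X` that differ everywhere is a regular group. -/
theorem exists_subgroup_of_family {n : ℕ} (o : Fin n) (ρ : Fin n → Equiv.Perm (Fin n))
    (h1 : ρ o = 1) (hd : ∀ I J x, I ≠ J → ρ I x ≠ ρ J x) (hsq : ∀ I, ρ I * ρ I = 1)
    (hc : ∀ I J, ρ I * ρ J = ρ J * ρ I) :
    ∃ G : Subgroup (Equiv.Perm (Fin n)), (G : Set (Equiv.Perm (Fin n))) = Set.range ρ ∧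
      ∀ x, Function.Bijective fun g : G => g.1 x := by
  have hinj : ∀ x, Function.Injective fun I => ρ I x := by
    intro x I J h
    by_contra hne
    exact hd I J x hne h
  have hsurj : ∀ x, Function.Surjective fun I => ρ I x := fun x =>
    Finite.surjective_of_injective (hinj x)
  have hinv : ∀ I, (ρ I)⁻¹ = ρ I := fun I => inv_eq_of_mul_eq_one_left (hsq I)
  refine ⟨⟨⟨⟨Set.range ρ, ?_⟩, ⟨o, h1⟩⟩, ?_⟩, rfl, ?_⟩
  · rintro _ _ ⟨I, rfl⟩ ⟨J, rfl⟩
    -- Both `ρ K` and the product commute with every `ρ M`; agreeing at `o`, they agree at every `ρ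
    -- M o`, hence everywhere.
    obtain ⟨K, hK⟩ := hsurj o ((ρ I * ρ J) o)
    refine ⟨K, Equiv.ext fun x => ?_⟩
    obtain ⟨M, rfl⟩ := hsurj o x
    have e1 : ρ K * ρ M = ρ M * ρ K := hc _ _
    have e2 : ρ I * ρ J * ρ M = ρ M * (ρ I * ρ J) := by
      rw [mul_assoc, hc J M, ← mul_assoc, hc I M, mul_assoc]
    have e1' := congrArg (fun g => g o) e1
    have e2' := congrArg (fun g => g o) e2
    simp only [Equiv.Perm.mul_apply] at e1' e2' hK ⊢
    rw [e1', e2', hK]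
  · rintro _ ⟨I, rfl⟩
    exact ⟨I, (hinv I).symm⟩
  · intro x
    constructor
    · rintro ⟨_, I, rfl⟩ ⟨_, J, rfl⟩ h
      have : I = J := hinj x h
      subst this; rfl
    · intro y
      obtain ⟨I, hI⟩ := hsurj x y
      exact ⟨⟨ρ I, I, rfl⟩, hI⟩

theorem regular_A (x : Fin 8) : Function.Bijective fun g : A => g.1 x := by
  constructor
  · rintro ⟨g, hg⟩ ⟨h, hh⟩ e
    obtain ⟨u, rfl⟩ := (mem_A_iff _).1 hg
    obtain ⟨v, rfl⟩ := (mem_A_iff _).1 hh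
    have h : ∀ x u v : Fin 8, x ^^^ u = x ^^^ v → u = v := by decide +kernel
    exact Subtype.ext (congrArg xorPerm (h x u v e))
  · intro y
    exact ⟨⟨xorPerm (x ^^^ y), (mem_A_iff _).2 ⟨_, rfl⟩⟩, by
      simp only [xorPerm_apply]; revert x y; decide⟩

theorem card_A : Nat.card A = 8 := by
  rw [Nat.card_congr (Equiv.ofBijective _ (regular_A 0))]; simp

theorem mul_self_A (g : A) : g * g = 1 := by
  obtain ⟨g, hg⟩ := g
  obtain ⟨u, rfl⟩ := (mem_A_iff _).1 hg
  ext x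
  simp [xor_xor_cancel]

/-- The indexed form of the classification of regular elementary abelian groups on eight points. -/
theorem exists_conj_xorPerm (ρ : Fin 8 → Equiv.Perm (Fin 8))
    (h1 : ρ 0 = 1) (hd : ∀ I J x, I ≠ J → ρ I x ≠ ρ J x) (hsq : ∀ I, ρ I * ρ I = 1)
    (hc : ∀ I J, ρ I * ρ J = ρ J * ρ I) :
    ∃ (g : Equiv.Perm (Fin 8)) (τ : Equiv.Perm (Fin 8)), ∀ I, ρ I = g * xorPerm (τ I) * g⁻¹ := by
  obtain ⟨G, hG, hreg⟩ := exists_subgroup_of_family 0 ρ h1 hd hsq hc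
  have hmem : ∀ g, g ∈ G ↔ ∃ I, ρ I = g := fun g => by
    rw [← SetLike.mem_coe, hG]; rfl
  have hcard : Nat.card A = Nat.card G := by
    rw [card_A, Nat.card_congr (Equiv.ofBijective _ (hreg 0))]; simp
  have hsqG : ∀ g : G, g * g = 1 := by
    rintro ⟨g, hg⟩
    obtain ⟨I, rfl⟩ := (hmem _).1 hg
    exact Subtype.ext (hsq I)
  obtain ⟨φ⟩ := nonempty_mulEquiv_of_mul_self mul_self_A hsqG hcard
  obtain ⟨c, hcG⟩ := exists_conj_of_regular φ 0 (regular_A 0) (hreg 0)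
  have : ∀ I, ∃ v, ρ I = c * xorPerm v * c⁻¹ := by
    intro I
    have hI : ρ I ∈ G := (hmem _).2 ⟨I, rfl⟩
    rw [hcG] at hI
    obtain ⟨b, hb, e⟩ := hI
    obtain ⟨v, rfl⟩ := (mem_A_iff _).1 hb
    exact ⟨v, e.symm⟩
  choose t ht using this
  have tinj : Function.Injective t := by
    intro I J h
    by_contra hne
    exact hd I J 0 hne (by rw [ht I, ht J, h])
  exact ⟨c, Equiv.ofBijective t (Finite.injective_iff_bijective.1 tinj), ht⟩

/-! ### The normalizer of `A` and the number of conjugates -/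

/-- The linear map with prescribed values on `1, 2, 4`. -/
def linMap (p : Fin 8 × Fin 8 × Fin 8) (x : Fin 8) : Fin 8 :=
  (if x.val.testBit 0 then p.1 else 0) ^^^ (if x.val.testBit 1 then p.2.1 else 0) ^^^
    (if x.val.testBit 2 then p.2.2 else 0)

/-- The bases of the vector space of bit strings of length three. -/
def linFrames : Finset (Fin 8 × Fin 8 × Fin 8) :=
  Finset.univ.filter fun p => p.1 ≠ 0 ∧ p.2.1 ≠ 0 ∧ p.2.1 ≠ p.1 ∧
    p.2.2 ≠ 0 ∧ p.2.2 ≠ p.1 ∧ p.2.2 ≠ p.2.1 ∧ p.2.2 ≠ p.1 ^^^ p.2.1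

/-- This is |GL(3,2)| = (8 − 1)(8 − 2)(8 − 4). -/
theorem card_linFrames : linFrames.card = 168 := by decide +kernel

theorem linMap_eq_zero : ∀ p ∈ linFrames, ∀ x, linMap p x = 0 → x = 0 := by
  decide +kernel

theorem zero_xor' : ∀ x : Fin 8, 0 ^^^ x = x := by decide

theorem xor_self' : ∀ x : Fin 8, x ^^^ x = 0 := by decide

theorem linMap_frame : ∀ p, (linMap p 1, linMap p 2, linMap p 4) = p := by
  rintro ⟨p, q, r⟩
  simp [linMap, Nat.testBit, zero_xor']

theorem ite_xor_ite (b c : Bool) (p : Fin 8) :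
    (if (b ^^ c) = true then p else 0) = (if b = true then p else 0) ^^^ (if c = true then p else 0) := by
  revert b c p; decide

theorem linMap_xor (p) (x y : Fin 8) : linMap p (x ^^^ y) = linMap p x ^^^ linMap p y := by
  have h : ∀ x y : Fin 8, (x ^^^ y).val = x.val ^^^ y.val := by decide
  simp only [linMap, h, Nat.testBit_xor, ite_xor_ite]
  let _ : Std.Associative (α := Fin 8) (· ^^^ ·) := ⟨xor_assoc'⟩
  let _ : Std.Commutative (α := Fin 8) (· ^^^ ·) := ⟨xor_comm'⟩
  ac_rfl

theorem eq_linMap_of_additive (d : Fin 8 → Fin 8) (h : ∀ x y, d (x ^^^ y) = d x ^^^ d y) (x) :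
    d x = linMap (d 1, d 2, d 4) x := by
  have h0 : d 0 = 0 := by
    have h1 := h 0 0
    rw [xor_self', xor_self'] at h1
    exact h1
  have hx : linMap (1, 2, 4) x = x := by revert x; decide
  have hite : ∀ (b : Bool) v, d (if b = true then v else 0) = if b = true then d v else 0 := by
    intro b v; cases b <;> simp [h0]
  conv_lhs => rw [← hx]
  simp only [linMap, h, hite]

/-- The elements `g` of `S₈` with `g A g⁻¹ = A`. -/
def normalizingA : Set (Equiv.Perm (Fin 8)) := {g | A.map (MulAut.conj g).toMonoidHom = A}

/-- The normalizer of the translation group consists of the affine maps: conjugation by an affine g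
turns translation by y into translation by g 0 + g y. -/
theorem mem_normalizingA_iff (g : Equiv.Perm (Fin 8)) :
    g ∈ normalizingA ↔ ∀ x y, g (x ^^^ y) = g x ^^^ g 0 ^^^ g y := by
  constructor
  · intro hg x y
    have : g * xorPerm y * g⁻¹ ∈ A := by
      rw [← (show _ = A from hg)]
      exact ⟨_, (mem_A_iff _).2 ⟨y, rfl⟩, rfl⟩
    obtain ⟨v, hv⟩ := (mem_A_iff _).1 this
    rw [eq_mul_inv_iff_mul_eq] at hv
    have h1 : g x ^^^ v = g (x ^^^ y) := congrArg (fun k => k x) hv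
    have h2 : g 0 ^^^ v = g (0 ^^^ y) := congrArg (fun k => k 0) hv
    rw [zero_xor', xor_eq_iff] at h2
    rw [← h1, h2, xor_assoc']
  · intro h
    have key : ∀ y, g * xorPerm y * g⁻¹ = xorPerm (g 0 ^^^ g y) := by
      intro y
      rw [mul_inv_eq_iff_eq_mul]
      ext x
      simp only [Equiv.Perm.mul_apply, xorPerm_apply]
      rw [h, xor_assoc']
    refine Subgroup.eq_of_le_of_card_ge ?_ ?_
    · rintro _ ⟨b, hb, rfl⟩
      obtain ⟨y, rfl⟩ := (mem_A_iff _).1 hb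
      exact (mem_A_iff _).2 ⟨_, (key y).symm⟩
    · rw [Subgroup.card_map_of_injective (MulAut.conj g).injective]

theorem translate_additive {g : Equiv.Perm (Fin 8)} (hg : g ∈ normalizingA) (x y : Fin 8) :
    g 0 ^^^ g (x ^^^ y) = (g 0 ^^^ g x) ^^^ (g 0 ^^^ g y) := by
  rw [(mem_normalizingA_iff g).1 hg x y]
  simp only [xor_assoc']

theorem eq_of_xor_eq {a x y : Fin 8} (h : a ^^^ x = a ^^^ y) : x = y := by
  rw [xor_eq_iff, ← xor_assoc', xor_self', zero_xor'] at h
  exact h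

/-- An affine bijection amounts to the image of the origin together with a basis, the image of 1, 2,
4 under its linear part: 8 · 168. -/
theorem ncard_normalizingA : normalizingA.ncard = 1344 := by
  let F : Equiv.Perm (Fin 8) → Fin 8 × Fin 8 × Fin 8 × Fin 8 :=
    fun g => (g 0, g 0 ^^^ g 1, g 0 ^^^ g 2, g 0 ^^^ g 4)
  have hinj : Set.InjOn F normalizingA := by
    intro g hg h hh e
    obtain ⟨e0, e1⟩ := Prod.ext_iff.1 e
    ext1 x
    have := (eq_linMap_of_additive (fun x => g 0 ^^^ g x) (translate_additive hg) x).trans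
      ((congrArg (fun p => linMap p x) e1).trans
        (eq_linMap_of_additive (fun x => h 0 ^^^ h x) (translate_additive hh) x).symm)
    simp only [F] at e0
    rw [e0] at this
    exact eq_of_xor_eq this
  have himg : F '' normalizingA = ((Finset.univ ×ˢ linFrames :
      Finset (Fin 8 × Fin 8 × Fin 8 × Fin 8)) : Set (Fin 8 × Fin 8 × Fin 8 × Fin 8)) := by
    ext ⟨p, q⟩
    simp only [Set.mem_image, Finset.coe_product, Finset.coe_univ, Set.mem_prod, Set.mem_univ,
      true_and, Finset.mem_coe]
    constructor
    · rintro ⟨g, hg, e⟩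
      obtain rfl : (F g).2 = q := congrArg Prod.snd e
      have hne : ∀ x y : Fin 8, x ≠ y → g 0 ^^^ g x ≠ g 0 ^^^ g y := fun x y hxy h =>
        hxy (g.injective (eq_of_xor_eq h))
      -- Since 1 + 2 = 3, the last frame condition becomes injectivity at 4 and 3.
      have h3 := translate_additive hg 1 2
      simp only [linFrames, Finset.mem_filter, Finset.mem_univ, true_and, F]
      have hz : ∀ x : Fin 8, x ≠ 0 → g 0 ^^^ g x ≠ 0 := fun x hx => by
        have := hne x 0 hx
        rwa [xor_self'] at this
      rw [← h3]
      exact ⟨hz _ (by decide), hz _ (by decide), hne _ _ (by decide), hz _ (by decide),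
        hne _ _ (by decide), hne _ _ (by decide), hne _ _ (by decide)⟩
    · intro hq
      have hb : Function.Bijective fun x => p ^^^ linMap q x := by
        refine Finite.injective_iff_bijective.1 fun x y h => ?_
        have h' := eq_of_xor_eq h
        have := linMap_eq_zero q hq (x ^^^ y) (by rw [linMap_xor, h', xor_self'])
        rw [xor_eq_iff] at this
        rw [this, xor_comm', zero_xor']
      have h0 : linMap q 0 = 0 := by simp [linMap]
      have hp : p ^^^ 0 = p := by rw [xor_comm', zero_xor']
      refine ⟨Equiv.ofBijective _ hb, (mem_normalizingA_iff _).2 fun x y => ?_, ?_⟩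
      · simp only [Equiv.ofBijective_apply, h0, hp, linMap_xor]
        rw [xor_assoc' _ p, ← xor_assoc' p p, xor_self', zero_xor', xor_assoc']
      · simp only [F, Equiv.ofBijective_apply, h0, hp, ← xor_assoc', xor_self', zero_xor',
          linMap_frame]
  rw [← hinj.ncard_image, himg, Set.ncard_coe_finset, Finset.card_product,
    card_linFrames, Finset.card_univ, Fintype.card_fin]

theorem ncard_conjugatesOfA : conjugatesOfA.ncard = 30 := by
  have hfin : conjugatesOfA.Finite := Set.toFinite _
  have h := ncard_eq_mul_of_fibers (s := Set.univ) (t := conjugatesOfA) (m := 1344)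
    (fun g : Equiv.Perm (Fin 8) => A.map (MulAut.conj g).toMonoidHom) (by norm_num) hfin
    (fun g _ => ⟨g, rfl⟩) ?_
  · rw [Set.ncard_univ, Nat.card_eq_fintype_card, Fintype.card_perm, Fintype.card_fin,
      show Nat.factorial 8 = 40320 by decide] at h
    omega
  · rintro _ ⟨g, rfl⟩
    -- The fibre over g A g⁻¹ is the coset of the normalizer by g.
    rw [← ncard_normalizingA, ← Set.ncard_image_of_injective normalizingA (mul_right_injective g)]
    congr 1
    ext k
    have hmul : ∀ x y : Equiv.Perm (Fin 8), A.map (MulAut.conj (x * y)).toMonoidHom =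
        (A.map (MulAut.conj y).toMonoidHom).map (MulAut.conj x).toMonoidHom := by
      intro x y
      rw [Subgroup.map_map, map_mul]; rfl
    simp only [Set.mem_univ, true_and, Set.mem_ofPred_eq, Set.mem_image]
    constructor
    · intro h
      refine ⟨g⁻¹ * k, ?_, by simp⟩
      rw [normalizingA, Set.mem_ofPred_eq, hmul, h, ← hmul]
      simp
      exact Subgroup.map_id _
    · rintro ⟨n, hn, rfl⟩
      rw [hmul, show A.map (MulAut.conj n).toMonoidHom = A from hn]

theorem card_of_mem_conjugatesOfA {B} (hB : B ∈ conjugatesOfA) : Nat.card B = 8 := by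
  obtain ⟨g, rfl⟩ := hB
  rw [Subgroup.card_map_of_injective (MulAut.conj g).injective, card_A]

theorem card_quotient_of_mem_conjugatesOfA {B} (hB : B ∈ conjugatesOfA) :
    Nat.card (Equiv.Perm (Fin 8) ⧸ B) = 5040 := by
  have := Subgroup.card_eq_card_quotient_mul_card_subgroup B
  rw [card_of_mem_conjugatesOfA hB, Nat.card_eq_fintype_card, Fintype.card_perm, Fintype.card_fin,
    show Nat.factorial 8 = 40320 by decide] at this
  omega

/-! ### Signed permutation matrices -/

open Matrix

/-- The sign of a bit. -/
def bitSign (b : Bool) : ℝ := if b then -1 else 1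

theorem bitSign_mul (b c : Bool) : bitSign b * bitSign c = bitSign (b ^^ c) := by
  cases b <;> cases c <;> simp [bitSign]

theorem bitSign_mul_self (b : Bool) : bitSign b * bitSign b = 1 := by
  cases b <;> simp [bitSign]

theorem bitSign_injective : Function.Injective bitSign := by
  intro b c h
  revert h
  cases b <;> cases c <;> norm_num [bitSign]

theorem bitSign_add_eq_zero_iff (b c : Bool) : bitSign b + bitSign c = 0 ↔ (b ^^ c) = true := by
  cases b <;> cases c <;> norm_num [bitSign]

theorem exists_bitSign {x : ℝ} (h : x = 1 ∨ x = -1) : ∃ b, x = bitSign b := by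
  rcases h with rfl | rfl
  · exact ⟨false, rfl⟩
  · exact ⟨true, rfl⟩

theorem abs_bitSign (b : Bool) : |bitSign b| = 1 := by cases b <;> simp [bitSign]

theorem bitSign_ne_zero (b : Bool) : bitSign b ≠ 0 := by cases b <;> simp [bitSign]

/-- The signed permutation matrix with row signs `s` and permutation `σ`. -/
def signedMat {d : ℕ} (s : Fin d → Bool) (σ : Equiv.Perm (Fin d)) : Matrix (Fin d) (Fin d) ℝ :=
  Matrix.of fun i j => if i = σ j then bitSign (s i) else 0

theorem diagonal_mul_permMat {d : ℕ} (s : Fin d → Bool) (σ : Equiv.Perm (Fin d)) :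
    Matrix.diagonal (fun i => bitSign (s i)) * permMat σ = signedMat s σ := by
  ext i j
  simp [Matrix.diagonal_mul, permMat, signedMat]

theorem absMatrix_signedMat {d : ℕ} (s : Fin d → Bool) (σ : Equiv.Perm (Fin d)) :
    absMatrix (signedMat s σ) = permMat σ := by
  ext i j
  simp only [absMatrix, signedMat, permMat, Matrix.map_apply, Matrix.of_apply]
  split_ifs <;> simp [abs_bitSign]

theorem permMat_injective {d : ℕ} : Function.Injective (permMat (d := d)) := by
  intro σ τ h
  ext1 j
  have := congrFun (congrFun h (σ j)) j
  simpa [permMat] using this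

theorem isSignedPerm_signedMat {d : ℕ} (s : Fin d → Bool) (σ : Equiv.Perm (Fin d)) :
    IsSignedPerm (signedMat s σ) := by
  have h : ∀ i j, signedMat s σ i j ≠ 0 ↔ i = σ j := by
    intro i j
    simp [signedMat, bitSign_ne_zero]
  refine ⟨fun i => ⟨σ⁻¹ i, ?_, ?_⟩, fun j => ⟨σ j, ?_, ?_⟩, fun i j hij => ?_⟩
  · simp [h]
  · intro j hj
    rw [(h i j).1 hj]; simp
  · simp [h]
  · intro i hi
    exact (h i j).1 hi
  · rw [h] at hij
    simp only [signedMat, Matrix.of_apply, if_pos hij]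
    cases s i <;> simp [bitSign]

theorem IsSignedPerm.exists_eq {d : ℕ} {M : Matrix (Fin d) (Fin d) ℝ} (h : IsSignedPerm M) :
    ∃ s σ, M = signedMat s σ := by
  obtain ⟨h1, h2, h3⟩ := h
  choose p hp hp' using h2
  choose q hq hq' using h1
  have hb : Function.Bijective p := by
    refine Finite.injective_iff_bijective.1 fun j k hjk => ?_
    rw [hq' (p j) j (hp j), hq' (p j) k (by rw [hjk]; exact hp k)]
  have : ∀ i, ∃ b, M i (q i) = bitSign b := fun i => exists_bitSign (h3 _ _ (hq i))
  choose s hs using this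
  refine ⟨s, Equiv.ofBijective p hb, ?_⟩
  ext i j
  simp only [signedMat, Matrix.of_apply, Equiv.ofBijective_apply]
  split_ifs with hij
  · rw [← hs, hq' i j (by rw [hij]; exact hp j)]
  · by_contra hne
    exact hij (hp' j i hne)

theorem signedMat_conj {d : ℕ} (s : Fin d → Bool) (h k σ : Equiv.Perm (Fin d)) :
    permMat h * signedMat s σ * permMat k = signedMat (fun i => s (h⁻¹ i)) (h * σ * k) := by
  have e : ∀ i j, i = h j ↔ j = h⁻¹ i := fun i j => by rw [Equiv.Perm.eq_inv_iff_eq, eq_comm]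
  ext i j
  simp only [Matrix.mul_apply, permMat, signedMat, Matrix.of_apply, Equiv.Perm.mul_apply]
  simp only [e, ite_mul, one_mul, zero_mul, mul_ite, mul_one, mul_zero, Finset.sum_ite_eq',
    Finset.mem_univ, if_true]
  by_cases hj : σ (k j) = h⁻¹ i
  · simp only [← hj]
  · simp only [if_neg hj]

theorem permMat_eq_signedMat {d : ℕ} (σ : Equiv.Perm (Fin d)) :
    permMat σ = signedMat (fun _ => false) σ := by
  ext i j; simp [permMat, signedMat, bitSign]

theorem permMat_one {d : ℕ} : permMat (1 : Equiv.Perm (Fin d)) = 1 := by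
  ext i j; simp [permMat, Matrix.one_apply]; congr

theorem permMat_mul {d : ℕ} (σ τ : Equiv.Perm (Fin d)) :
    permMat σ * permMat τ = permMat (σ * τ) := by
  have := signedMat_conj (fun _ => false) σ τ 1
  rw [← permMat_eq_signedMat, ← permMat_eq_signedMat, permMat_one] at this
  simpa using this

theorem permMat_transpose {d : ℕ} (σ : Equiv.Perm (Fin d)) : (permMat σ)ᵀ = permMat σ⁻¹ := by
  ext i j
  simp only [permMat, Matrix.transpose_apply, Matrix.of_apply]
  simp only [Equiv.Perm.eq_inv_iff_eq, eq_comm]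

/-- In each product one permutation matrix cancels in the middle and the other conjugates a scalar
matrix, which it fixes. -/
theorem IsGR.conj {d N : ℕ} {M : Fin N → Matrix (Fin d) (Fin d) ℝ} (hM : IsGR d N M)
    (τ : Equiv.Perm (Fin N)) (h k : Equiv.Perm (Fin d)) :
    IsGR d N fun I => permMat h * M (τ I) * permMat k := by
  obtain ⟨h1, h2, h3⟩ := hM
  have c (σ : Equiv.Perm (Fin d)) : permMat σ * permMat σ⁻¹ = 1 := by
    rw [permMat_mul, mul_inv_cancel, permMat_one]
  have c' (σ : Equiv.Perm (Fin d)) : permMat σ⁻¹ * permMat σ = 1 := by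
    rw [permMat_mul, inv_mul_cancel, permMat_one]
  refine ⟨fun I => ?_, fun I J => ?_, fun I J => ?_⟩
  · obtain ⟨s, σ, e⟩ := (h1 (τ I)).exists_eq
    simp only [e, signedMat_conj]
    exact isSignedPerm_signedMat _ _
  · have key : ∀ X Y : Matrix (Fin d) (Fin d) ℝ,
        permMat h * X * permMat k * (permMat h * Y * permMat k)ᵀ =
          permMat h * (X * Yᵀ) * permMat h⁻¹ := by
      intro X Y
      simp only [Matrix.transpose_mul, permMat_transpose, Matrix.mul_assoc]
      rw [← Matrix.mul_assoc (permMat k), c, Matrix.one_mul]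
    simp only [key]
    rw [← Matrix.add_mul, ← Matrix.mul_add, h2]
    simp [c]
  · have key : ∀ X Y : Matrix (Fin d) (Fin d) ℝ,
        (permMat h * X * permMat k)ᵀ * (permMat h * Y * permMat k) =
          permMat k⁻¹ * (Xᵀ * Y) * permMat k := by
      intro X Y
      simp only [Matrix.transpose_mul, permMat_transpose, Matrix.mul_assoc]
      rw [← Matrix.mul_assoc (permMat h⁻¹), c', Matrix.one_mul]
    simp only [key]
    rw [← Matrix.add_mul, ← Matrix.mul_add, h3]
    simp [c']

/-! ### Realizations by signed translations -/

theorem signedMat_xorPerm_apply (s : Fin 8 → Bool) (v i j : Fin 8) :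
    signedMat s (xorPerm v) i j = if j = i ^^^ v then bitSign (s i) else 0 := by
  have h : ∀ i j v : Fin 8, i = j ^^^ v ↔ j = i ^^^ v := by decide +kernel
  simp [signedMat, h]

theorem signedMat_transpose_mul_apply {d : ℕ} (s t : Fin d → Bool) (σ τ : Equiv.Perm (Fin d))
    (i k : Fin d) : ((signedMat s σ)ᵀ * signedMat t τ) i k =
      if σ i = τ k then bitSign (s (σ i)) * bitSign (t (σ i)) else 0 := by
  simp only [Matrix.mul_apply, Matrix.transpose_apply, signedMat, Matrix.of_apply,
    ite_mul, zero_mul, Finset.sum_ite_eq', Finset.mem_univ, if_true, mul_ite, mul_zero]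
  by_cases e : τ k = σ i
  · simp only [e, if_true]
  · rw [if_neg e, if_neg (Ne.symm e)]

theorem xorPerm_transpose_mul_apply (s t : Fin 8 → Bool) (u v i k : Fin 8) :
    ((signedMat s (xorPerm u))ᵀ * signedMat t (xorPerm v)) i k =
      if k = i ^^^ u ^^^ v then bitSign (s (i ^^^ u)) * bitSign (t (i ^^^ u)) else 0 := by
  have h : ∀ i u v k : Fin 8, i ^^^ u = k ^^^ v ↔ k = i ^^^ u ^^^ v := by decide +kernel
  simp only [signedMat_transpose_mul_apply, xorPerm_apply, h]

theorem xorPerm_mul_transpose_apply (s t : Fin 8 → Bool) (u v i k : Fin 8) :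
    (signedMat s (xorPerm u) * (signedMat t (xorPerm v))ᵀ) i k =
      if k = i ^^^ u ^^^ v then bitSign (s i) * bitSign (t k) else 0 := by
  have h : ∀ i u v k : Fin 8, k ^^^ v = i ^^^ u ↔ k = i ^^^ u ^^^ v := by decide +kernel
  simp only [Matrix.mul_apply, Matrix.transpose_apply, signedMat_xorPerm_apply,
    ite_mul, zero_mul, Finset.sum_ite_eq', Finset.mem_univ, if_true, h, mul_ite,
    mul_zero]

theorem xor_right_comm' (i u v : Fin 8) : i ^^^ u ^^^ v = i ^^^ v ^^^ u := by
  rw [xor_assoc', xor_comm' u, xor_assoc']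

/-- Translations commute, so both summands of a relation are supported on the same positions k = i +
u + v. For u ≠ v the two signs there must cancel, which is one equation on four sign bits; for u = v
the relation is automatic. Either family of relations yields the same equations. -/
theorem isGR_signedMat_xorPerm_iff (f : Fin 8 → Fin 8 → Bool) :
    IsGR 8 8 (fun v => signedMat (f v) (xorPerm v)) ↔ IsComposition f := by
  have e : ∀ a b c d : Bool, bitSign a * bitSign b + bitSign c * bitSign d = 0 ↔
      (a ^^ b ^^ (c ^^ d)) = true := fun a b c d => by
    rw [bitSign_mul, bitSign_mul, bitSign_add_eq_zero_iff]
  constructor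
  · rintro ⟨-, -, h⟩ u v x huv
    have := congrFun (congrFun (h u v) (x ^^^ u)) (x ^^^ v)
    rw [if_neg huv, Matrix.add_apply, xorPerm_transpose_mul_apply, xorPerm_transpose_mul_apply,
      if_pos (by rw [xor_xor_cancel]), if_pos (by rw [xor_right_comm', xor_xor_cancel]),
      xor_xor_cancel] at this
    simp only [mul_zero, zero_smul, Matrix.zero_apply] at this
    rw [e] at this
    rw [← this]
    cases f u x <;> cases f v x <;> cases f u (x ^^^ u ^^^ v) <;> cases f v (x ^^^ u ^^^ v) <;> rfl
  · intro h
    refine ⟨fun v => isSignedPerm_signedMat _ _, fun u v => ?_, fun u v => ?_⟩ <;> ext i k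
    · rw [Matrix.add_apply, xorPerm_mul_transpose_apply, xorPerm_mul_transpose_apply,
        xor_right_comm' i v u]
      by_cases huv : u = v
      · subst huv
        rw [xor_xor_cancel]
        by_cases hk : k = i
        · subst hk
          simp [bitSign_mul_self]; norm_num
        · simp [hk, Ne.symm hk]
      · rw [if_neg huv]
        simp only [mul_zero, zero_smul, Matrix.zero_apply]
        split_ifs with hk
        · rw [e, ← h u v i huv, hk]
          cases f u i <;> cases f v i <;> cases f u (i ^^^ u ^^^ v) <;>
            cases f v (i ^^^ u ^^^ v) <;> rfl
        · simp
    · rw [Matrix.add_apply, xorPerm_transpose_mul_apply, xorPerm_transpose_mul_apply,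
        xor_right_comm' i v u]
      by_cases huv : u = v
      · subst huv
        rw [xor_xor_cancel]
        by_cases hk : k = i
        · subst hk
          simp [bitSign_mul_self]; norm_num
        · simp [hk, Ne.symm hk]
      · rw [if_neg huv]
        simp only [mul_zero, zero_smul, Matrix.zero_apply]
        split_ifs with hk
        · rw [e, ← h u v (i ^^^ u) huv, xor_xor_cancel]
          cases f u (i ^^^ u) <;> cases f v (i ^^^ u) <;> cases f u (i ^^^ v) <;>
            cases f v (i ^^^ v) <;> rfl
        · simp

theorem isSignMatrix_iff {d : ℕ} (M : Matrix (Fin d) (Fin d) ℝ) :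
    IsSignMatrix M ↔ ∃ s : Fin d → Bool, M = Matrix.diagonal fun i => bitSign (s i) := by
  constructor
  · rintro ⟨s, hs, rfl⟩
    choose b hb using fun i => exists_bitSign (hs i)
    exact ⟨b, congrArg _ (funext hb)⟩
  · rintro ⟨s, rfl⟩
    refine ⟨_, fun i => ?_, rfl⟩
    cases s i <;> simp [bitSign]

/-- The number of sign choices for a family of permutations equivalent to the translations. -/
theorem ncard_signs (h k τ : Equiv.Perm (Fin 8)) :
    {E : Fin 8 → Matrix (Fin 8) (Fin 8) ℝ | (∀ I, IsSignMatrix (E I)) ∧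
      IsGR 8 8 (fun I => E I * permMat (h * xorPerm (τ I) * k))}.ncard = 2 ^ 19 := by
  -- Left multiplication by `permMat h` moves row x to row h x, so the signs are read at `h⁻¹ i`.
  let Ψ : (Fin 8 → Fin 8 → Bool) → Fin 8 → Matrix (Fin 8) (Fin 8) ℝ := fun f I =>
    Matrix.diagonal fun i => bitSign (f (τ I) (h⁻¹ i))
  have hΨ : Function.Injective Ψ := by
    intro f g e
    funext v x
    have := congrFun (congrFun (congrFun e (τ⁻¹ v)) (h x)) (h x)
    simp only [Ψ, Matrix.diagonal_apply_eq] at this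
    simpa using bitSign_injective this
  have key : ∀ f, IsGR 8 8 (fun I => Ψ f I * permMat (h * xorPerm (τ I) * k)) ↔
      IsComposition f := by
    intro f
    have e1 : (fun I => Ψ f I * permMat (h * xorPerm (τ I) * k)) =
        fun I => permMat h * (fun v => signedMat (f v) (xorPerm v)) (τ I) * permMat k := by
      funext I
      rw [signedMat_conj, ← diagonal_mul_permMat]
    rw [← isGR_signedMat_xorPerm_iff, e1]
    refine ⟨fun H => ?_, fun H => H.conj τ h k⟩
    have := H.conj τ⁻¹ h⁻¹ k⁻¹
    convert this using 2 with v
    have e2 : permMat h⁻¹ * (permMat h * signedMat (f v) (xorPerm v) * permMat k) * permMat k⁻¹ =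
        (permMat h⁻¹ * permMat h) * signedMat (f v) (xorPerm v) * (permMat k * permMat k⁻¹) := by
      simp only [Matrix.mul_assoc]
    simp only [show τ (τ⁻¹ v) = v from τ.apply_symm_apply v]
    rw [e2, permMat_mul, permMat_mul]
    simp [permMat_one]
  rw [← ncard_isComposition, ← Set.ncard_image_of_injective _ hΨ]
  congr 1
  ext E
  simp only [Set.mem_ofPred_eq, Set.mem_image]
  constructor
  · rintro ⟨hE, hGR⟩
    choose s hs using fun I => (isSignMatrix_iff _).1 (hE I)
    let f : Fin 8 → Fin 8 → Bool := fun v x => s (τ⁻¹ v) (h x)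
    have : Ψ f = E := by
      funext I
      simp [Ψ, f, hs]
    refine ⟨f, (key _).1 ?_, this⟩
    rw [this]
    exact hGR
  · rintro ⟨f, hf, rfl⟩
    exact ⟨fun I => (isSignMatrix_iff _).2 ⟨_, rfl⟩, (key f).2 hf⟩

/-! ### The permutations underlying a realization -/

/-- Distinct members of a realization differ everywhere and are related by involutions. -/
theorem IsGR.perm_relations {d N : ℕ} {s : Fin N → Fin d → Bool}
    {π : Fin N → Equiv.Perm (Fin d)} (h : IsGR d N fun I => signedMat (s I) (π I)) {I J : Fin N}
    (hIJ : I ≠ J) (i : Fin d) : π I i ≠ π J i ∧ ∀ k, π I i = π J k → π J i = π I k := by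
  -- The (i, k) entry has at most two terms ±1, so both occur or neither does. For k = i they would
  -- be equal and could not cancel.
  have key : ∀ k, (if π I i = π J k then bitSign (s I (π I i)) * bitSign (s J (π I i)) else 0) +
      (if π J i = π I k then bitSign (s J (π J i)) * bitSign (s I (π J i)) else 0) = 0 := by
    intro k
    have := congrFun (congrFun (h.2.2 I J) i) k
    rw [if_neg hIJ, Matrix.add_apply, signedMat_transpose_mul_apply,
      signedMat_transpose_mul_apply] at this
    simpa using this
  constructor
  · intro e
    have := key i
    rw [if_pos e, if_pos e.symm, e, mul_comm (bitSign (s J _)), ← two_mul] at this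
    simp [bitSign_ne_zero] at this
  · intro k e
    by_contra hne
    have := key k
    rw [if_pos e, if_neg hne] at this
    simp [bitSign_ne_zero] at this

/-- The permutations underlying a realization of `GR(8,8)` form a coset of a conjugate of `A`. -/
theorem IsGR.exists_perm {L : Fin 8 → Matrix (Fin 8) (Fin 8) ℝ} (h : IsGR 8 8 L) :
    ∃ (s : Fin 8 → Fin 8 → Bool) (p g τ : Equiv.Perm (Fin 8)),
      ∀ I, L I = signedMat (s I) (p * (g * xorPerm (τ I) * g⁻¹)) := by
  choose s π hL using fun I => (h.1 I).exists_eq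
  obtain rfl : L = fun I => signedMat (s I) (π I) := funext hL
  have hrel : ∀ I J i, I ≠ J → _ := fun I J i hIJ => h.perm_relations (I := I) (J := J) hIJ i
  have hsq : ∀ I J, (π I)⁻¹ * π J * ((π I)⁻¹ * π J) = 1 := by
    intro I J
    by_cases hIJ : I = J
    · subst hIJ; simp
    · ext1 i
      have := (hrel I J ((π I)⁻¹ (π J i)) hIJ).2 i ((π I).apply_symm_apply _)
      have h2 : (π I)⁻¹ (π J ((π I)⁻¹ (π J i))) = i := by
        rw [this]; exact (π I).symm_apply_apply i
      exact h2
  have hsq0 : ∀ I, (π 0)⁻¹ * π I * ((π 0)⁻¹ * π I) = 1 := hsq 0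
  have hinv : ∀ I, ((π 0)⁻¹ * π I)⁻¹ = (π 0)⁻¹ * π I := fun I =>
    inv_eq_of_mul_eq_one_left (hsq0 I)
  obtain ⟨g, τ, hg⟩ := exists_conj_xorPerm (fun I => (π 0)⁻¹ * π I) (by simp) (fun I J x hIJ e => by
      simp only [Equiv.Perm.mul_apply] at e
      exact (hrel I J x hIJ).1 ((π 0)⁻¹.injective e)) hsq0 (fun I J => by
      -- The product of the involutions π_0⁻¹π_I and π_0⁻¹π_J is π_I⁻¹π_J, again an involution, so
      -- they commute.
      have h1 : (π I)⁻¹ * π J = ((π 0)⁻¹ * π I) * ((π 0)⁻¹ * π J) := by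
        rw [← hinv I]; simp [mul_assoc]
      have h2 := hsq I J
      rw [h1] at h2
      have h3 := inv_eq_of_mul_eq_one_left h2
      rw [← h3, _root_.mul_inv_rev, hinv, hinv])
  exact ⟨s, π 0, g, τ, fun I => by rw [← hg]; simp⟩

/-- The family underlying every realization of `GR(8,8)`, as given by `IsGR.exists_perm`. -/
def cosetPerm (p g τ : Equiv.Perm (Fin 8)) (I : Fin 8) : Equiv.Perm (Fin 8) :=
  p * (g * xorPerm (τ I) * g⁻¹)

theorem cosetPerm_injective (p g τ : Equiv.Perm (Fin 8)) :
    Function.Injective (cosetPerm p g τ) := by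
  intro I J h
  exact τ.injective (xorPerm_injective (by simpa [cosetPerm] using h))

theorem ncard_signs_cosetPerm (p g τ : Equiv.Perm (Fin 8)) :
    {E : Fin 8 → Matrix (Fin 8) (Fin 8) ℝ | (∀ I, IsSignMatrix (E I)) ∧
      IsGR 8 8 (fun I => E I * permMat (cosetPerm p g τ I))}.ncard = 2 ^ 19 := by
  have e : ∀ I, cosetPerm p g τ I = (p * g) * xorPerm (τ I) * g⁻¹ := fun I => by
    simp only [cosetPerm, mul_assoc]
  simp only [e]
  exact ncard_signs _ _ _

theorem cosetMatrices_conj (p g τ : Equiv.Perm (Fin 8)) :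
    cosetMatrices p (A.map (MulAut.conj g).toMonoidHom) =
      Set.range fun I => permMat (cosetPerm p g τ I) := by
  ext M
  constructor
  · rintro ⟨_, ⟨b, hb, rfl⟩, rfl⟩
    obtain ⟨v, rfl⟩ := (mem_A_iff _).1 hb
    exact ⟨τ⁻¹ v, by simp [cosetPerm]⟩
  · rintro ⟨I, rfl⟩
    exact ⟨_, ⟨xorPerm (τ I), (mem_A_iff _).2 ⟨_, rfl⟩, rfl⟩, rfl⟩

/-- The number of sign choices is nonzero, so one exists. -/
theorem exists_isGR_cosetPerm (p g τ : Equiv.Perm (Fin 8)) :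
    ∃ L, IsGR 8 8 L ∧ ∀ I, absMatrix (L I) = permMat (cosetPerm p g τ I) := by
  obtain ⟨E, hE, h⟩ := Set.nonempty_of_ncard_ne_zero
    (by rw [ncard_signs_cosetPerm p g τ]; norm_num)
  refine ⟨_, h, fun I => ?_⟩
  obtain ⟨s, hs⟩ := (isSignMatrix_iff _).1 (hE I)
  rw [hs, diagonal_mul_permMat, absMatrix_signedMat]

/-! ### Counting the unordered sets -/

theorem grAbsSets_eq :
    grAbsSets 8 8 = {P | ∃ B ∈ conjugatesOfA, ∃ π, P = cosetMatrices π B} := by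
  ext P
  constructor
  · rintro ⟨L, hL, rfl⟩
    obtain ⟨s, p, g, τ, h⟩ := hL.exists_perm
    refine ⟨_, ⟨g, rfl⟩, p, ?_⟩
    simp only [cosetMatrices_conj p g τ, h, absMatrix_signedMat, cosetPerm]
  · rintro ⟨_, ⟨g, rfl⟩, p, rfl⟩
    obtain ⟨L, hL, h⟩ := exists_isGR_cosetPerm p g 1
    exact ⟨L, hL, by simp only [cosetMatrices_conj p g 1, h]⟩

theorem cosetMatrices_eq_iff (p q : Equiv.Perm (Fin 8)) (B C : Subgroup (Equiv.Perm (Fin 8))) :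
    cosetMatrices p B = cosetMatrices q C ↔ B = C ∧ q⁻¹ * p ∈ C := by
  have hmem : ∀ (x r) (D : Subgroup (Equiv.Perm (Fin 8))),
      permMat x ∈ cosetMatrices r D ↔ r⁻¹ * x ∈ D := by
    intro x r D
    constructor
    · rintro ⟨b, hb, e⟩
      rw [permMat_injective e]
      simpa using hb
    · intro h
      exact ⟨_, h, by simp⟩
  constructor
  · intro h
    have hx : ∀ x, p⁻¹ * x ∈ B ↔ q⁻¹ * x ∈ C := fun x => by rw [← hmem, ← hmem, h]
    have hp : q⁻¹ * p ∈ C := (hx p).1 (by simp)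
    refine ⟨?_, hp⟩
    ext b
    have := hx (p * b)
    rw [inv_mul_cancel_left] at this
    rw [this, ← mul_assoc, C.mul_mem_cancel_left hp]
  · rintro ⟨rfl, h⟩
    have hx : ∀ x, p⁻¹ * x ∈ B ↔ q⁻¹ * x ∈ B := fun x => by
      rw [← B.mul_mem_cancel_left h]; simp [mul_assoc]
    ext M
    constructor
    · rintro ⟨b, hb, rfl⟩
      rw [hmem, ← hx]; simpa using hb
    · rintro ⟨b, hb, rfl⟩
      rw [hmem, hx]; simpa using hb

/-- Each coset comes from a unique subgroup and from its 8 representatives, so the 30 · 8! pairs are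
counted 8 times. -/
theorem ncard_grAbsSets : (grAbsSets 8 8).ncard = 30 * 5040 := by
  rw [grAbsSets_eq]
  set T := {P | ∃ B ∈ conjugatesOfA, ∃ π, P = cosetMatrices π B} with hT
  let F : Subgroup (Equiv.Perm (Fin 8)) × Equiv.Perm (Fin 8) → Set (Matrix (Fin 8) (Fin 8) ℝ) :=
    fun x => cosetMatrices x.2 x.1
  have himg : T = F '' (conjugatesOfA ×ˢ Set.univ) := by
    ext P
    constructor
    · rintro ⟨B, hB, π, rfl⟩
      exact ⟨(B, π), ⟨hB, trivial⟩, rfl⟩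
    · rintro ⟨⟨B, π⟩, ⟨hB, -⟩, rfl⟩
      exact ⟨B, hB, π, rfl⟩
  have hfin : T.Finite := himg ▸ (Set.toFinite _).image _
  have h := ncard_eq_mul_of_fibers (s := conjugatesOfA ×ˢ Set.univ) (m := 8) F (by norm_num) hfin
    (by rw [himg]; exact Set.mapsTo_image _ _) ?_
  · rw [Set.ncard_prod, ncard_conjugatesOfA, Set.ncard_univ, Nat.card_eq_fintype_card,
      Fintype.card_perm, Fintype.card_fin, show Nat.factorial 8 = 40320 by decide] at h
    omega
  · rintro _ ⟨B, hB, π, rfl⟩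
    have e : {x | x ∈ conjugatesOfA ×ˢ Set.univ ∧ F x = cosetMatrices π B} =
        (fun b => (B, π * b)) '' (B : Set (Equiv.Perm (Fin 8))) := by
      ext ⟨C, q⟩
      constructor
      · rintro ⟨-, hx⟩
        obtain ⟨rfl, hq⟩ := (cosetMatrices_eq_iff _ _ _ _).1 hx
        exact ⟨_, hq, by simp⟩
      · rintro ⟨b, hb, e⟩
        obtain ⟨rfl, rfl⟩ := Prod.ext_iff.1 e
        exact ⟨⟨hB, trivial⟩, (cosetMatrices_eq_iff _ _ _ _).2 ⟨rfl, by simpa using hb⟩⟩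
    rw [e, Set.ncard_image_of_injective]
    · exact card_of_mem_conjugatesOfA hB
    · intro b c hbc
      simpa using hbc

/-- The number of unordered realizations with prescribed absolute values. -/
theorem ncard_grSets_fiber {P} (hP : P ∈ grAbsSets 8 8) :
    {S | S ∈ grSets 8 8 ∧ absMatrix '' S = P}.ncard = 2 ^ 19 := by
  obtain ⟨L, hL, rfl⟩ := hP
  obtain ⟨s, p, g, τ, h⟩ := hL.exists_perm
  set π := cosetPerm p g τ with hπ
  have hπi : Function.Injective π := cosetPerm_injective p g τ
  have habs : ∀ I, absMatrix (L I) = permMat (π I) := fun I => by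
    rw [h, absMatrix_signedMat]; rfl
  -- Absolute values recover the index of each member because the π_I are distinct; hence forgetting
  -- the order loses nothing, and any set in the fibre can be reordered to match π.
  let Φ : (Fin 8 → Matrix (Fin 8) (Fin 8) ℝ) → Set (Matrix (Fin 8) (Fin 8) ℝ) :=
    fun E => Set.range fun I => E I * permMat (π I)
  have habsE : ∀ E : Matrix (Fin 8) (Fin 8) ℝ, IsSignMatrix E → ∀ σ,
      absMatrix (E * permMat σ) = permMat σ := by
    intro E hE σ
    obtain ⟨t, rfl⟩ := (isSignMatrix_iff _).1 hE
    rw [diagonal_mul_permMat, absMatrix_signedMat]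
  have hinj : Set.InjOn Φ {E | (∀ I, IsSignMatrix (E I)) ∧
      IsGR 8 8 (fun I => E I * permMat (π I))} := by
    rintro E ⟨hE, -⟩ E' ⟨hE', -⟩ e
    funext I
    have hmem : E I * permMat (π I) ∈ Φ E' := e ▸ ⟨I, rfl⟩
    obtain ⟨J, hJ⟩ := hmem
    have hJ' := congrArg absMatrix hJ
    simp only [habsE _ (hE _), habsE _ (hE' _)] at hJ'
    obtain rfl := hπi (permMat_injective hJ')
    have := congrArg (fun M => M * permMat (π J)⁻¹) hJ
    simpa [Matrix.mul_assoc, permMat_mul, permMat_one] using this.symm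
  rw [← ncard_signs_cosetPerm p g τ, ← hπ, ← hinj.ncard_image]
  congr 1
  ext S
  constructor
  · rintro ⟨⟨M, hM, rfl⟩, hS⟩
    choose t σ hσ using fun I => (hM.1 I).exists_eq
    have hex : ∀ I, ∃ J, σ J = π I := by
      intro I
      have : permMat (π I) ∈ absMatrix '' Set.range M := by
        rw [hS]; exact ⟨I, habs I⟩
      obtain ⟨_, ⟨J, rfl⟩, hJ⟩ := this
      rw [hσ, absMatrix_signedMat] at hJ
      exact ⟨J, permMat_injective hJ⟩
    choose r hr using hex
    have hri : Function.Injective r := fun I J e => hπi (by rw [← hr, ← hr, e])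
    have hrb := Finite.injective_iff_bijective.1 hri
    let E : Fin 8 → Matrix (Fin 8) (Fin 8) ℝ :=
      fun I => Matrix.diagonal fun i => bitSign (t (r I) i)
    have hE : ∀ I, E I * permMat (π I) = M (r I) := fun I => by
      rw [hσ, ← hr, ← diagonal_mul_permMat]
    refine ⟨E, ⟨fun I => (isSignMatrix_iff _).2 ⟨_, rfl⟩, ?_⟩, ?_⟩
    · simp only [hE]
      simpa [permMat_one] using hM.conj (Equiv.ofBijective r hrb) 1 1
    · simp only [Φ, hE]
      exact hrb.2.range_comp M
  · rintro ⟨E, ⟨hE, hGR⟩, rfl⟩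
    refine ⟨⟨_, hGR, rfl⟩, ?_⟩
    rw [← Set.range_comp]
    congr 1
    funext I
    simp only [Function.comp_apply, habsE _ (hE I), habs]

theorem ncard_grSets : (grSets 8 8).ncard = 79272345600 := by
  have h := ncard_eq_mul_of_fibers (s := grSets 8 8) (t := grAbsSets 8 8) (m := 2 ^ 19)
    (fun S => absMatrix '' S) (by norm_num)
    (Set.finite_of_ncard_ne_zero (by rw [ncard_grAbsSets]; norm_num))
    (by
      rintro _ ⟨L, hL, rfl⟩
      exact ⟨L, hL, (Set.range_comp _ _).symm⟩)
    (fun P hP => ncard_grSets_fiber hP)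
  rw [h, ncard_grAbsSets]; norm_num

theorem IsGR.ncard_signs {L : Fin 8 → Matrix (Fin 8) (Fin 8) ℝ} (hL : IsGR 8 8 L) :
    {E : Fin 8 → Matrix (Fin 8) (Fin 8) ℝ |
      (∀ I, IsSignMatrix (E I)) ∧ IsGR 8 8 (fun I => E I * absMatrix (L I))}.ncard = 2 ^ 19 := by
  obtain ⟨s, p, g, τ, h⟩ := hL.exists_perm
  simp only [h, absMatrix_signedMat]
  exact ncard_signs_cosetPerm p g τ

end GardenAlgebra

open GardenAlgebra in
theorem mainTheorem6 :
    -- `A` has exactly 30 conjugates, each of which has exactly 5040 left cosets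
    conjugatesOfA.ncard = 30 ∧
    (∀ B ∈ conjugatesOfA, Nat.card (Equiv.Perm (Fin 8) ⧸ B) = 5040) ∧
    -- the sets `{|L₁|, …, |L₈|}` are exactly the left cosets of the conjugates of `A`
    grAbsSets 8 8 = {P | ∃ B ∈ conjugatesOfA, ∃ π, P = cosetMatrices π B} ∧
    -- the number of sets `{|L₁|, …, |L₈|}`
    (grAbsSets 8 8).ncard = 30 * 5040 ∧
    (grAbsSets 8 8).ncard = 151200 ∧
    -- the number of choices of signs for given `|L₁|, …, |L₈|`
    (∀ L, IsGR 8 8 L →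
      {E : Fin 8 → Matrix (Fin 8) (Fin 8) ℝ |
        (∀ I, IsSignMatrix (E I)) ∧ IsGR 8 8 (fun I => E I * absMatrix (L I))}.ncard
          = 2 ^ 19) ∧
    -- the number of sets `{L₁, …, L₈}` with a given set `{|L₁|, …, |L₈|}`
    (∀ P ∈ grAbsSets 8 8, {S | S ∈ grSets 8 8 ∧ absMatrix '' S = P}.ncard = 2 ^ 19) ∧
    -- the number of sets `{L₁, …, L₈}`
    (grSets 8 8).ncard = 79272345600 :=
  ⟨ncard_conjugatesOfA, fun _ hB => card_quotient_of_mem_conjugatesOfA hB, grAbsSets_eq,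
    ncard_grAbsSets, ncard_grAbsSets, fun _ hL => hL.ncard_signs,
    fun _ hP => ncard_grSets_fiber hP, ncard_grSets⟩
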